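/- For $p\in(0,1]$, $v>0$, $r\ge0$ consider the discrete-time exclusion process on $\mathbb R$ with jump size $v$, jump probability $p$ and balls of radius $r$. A configuration is $x=(x_i)_{i\in\mathbb Z}\subset\mathbb R$ with $x_i+r\le x_{i+1}-r$ for all $i$. Independently for all particles $i\in\mathbb Z$ and all times $t\ge0$, $x_i^{t+1}=\min\{x_i^t+v,\;x_{i+1}^t-2r\}$ with probability $p$ and $x_i^{t+1}=x_i^t$ with probability $1-p$. The density of $x$ is $\rho(x)=\lim_{n\to\infty} n/(x_{n-1}-x_0)$. The average velocity $V(\rho,p,v,r)$ is the number such that, from every admissible initial configuration $x^0$ of density $\rho$, almost surely $(x_i^t-x_i^0)/t\to V(\rho,p,v,r)$ as $t\to\infty$ for every $i\in\mathbb Z$; it is called well defined if admissible configurations of density $\rho$ exist and there is exactly one such number. Let $v>0$ and $\rho>0$. For every $p\in(0,1]$ the average velocities $V(\rho,p,v,0)$, $V(v\rho,p,1,0)$ and $V\bigl(\tfrac{v\rho}{1+v\rho},p,1,\tfrac12\bigr)$ are well defined, and $$V(\rho,p,v,0)=v\,V(v\rho,p,1,0)=v\,V\Bigl(\frac{v\rho}{1+v\rho},p,1,\frac12\Bigr)=\frac{1+v\rho-\sqrt{(1+v\rho)^2-4pv\rho}}{2\rho}.$$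 Moreover $V(\rho,p,v,0)\to\min(v,1/\rho)$ as $p\to1$, $p<1$, and the average velocity is stochastically stable: this limit equals the average velocity of the deterministic process, that is, $V(\rho,1,v,0)=\min(v,1/\rho)$ and $V(\rho,p,v,0)\to V(\rho,1,v,0)$. -/

import Mathlib

open MeasureTheory ProbabilityTheory Filter Topology

namespace ExclusionProcess

/-- `x` is an admissible configuration of balls of radius `r` on the real line: the centres
are ordered and the balls do not overlap. For `r = 0` (point particles) several particles may
share a position. -/
def IsAdmissible (r : ℝ) (x : ℤ → ℝ) : Prop :=
  ∀ i : ℤ, x i + r ≤ x (i + 1) - r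

/-- The configuration `x` has density `ρ`: `n / (x_{n-1} - x_0) → ρ` as `n → ∞`. -/
def HasDensity (x : ℤ → ℝ) (ρ : ℝ) : Prop :=
  Tendsto (fun n : ℕ => (n : ℝ) / (x ((n : ℤ) - 1) - x 0)) atTop (𝓝 ρ)

/-- One realization of the random choices: `ω (i, t) = true` means that particle `i` attempts
to move between the times `t` and `t + 1`. -/
abbrev Choices : Type := ℤ × ℕ → Bool

/-- The law of the random choices: they are independent, and each is `true` with probability `p`
and `false` with probability `1 - p`. -/
noncomputable def choiceLaw (p : unitInterval) : Measure Choices :=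
  Measure.infinitePi fun _ : ℤ × ℕ => bernoulliMeasure true false p

/-- The configuration at time `t` of the exclusion process with jump size `v` and ball radius `r`,
started from `x` and driven by the choices `ω`. All particles are updated simultaneously. -/
noncomputable def evolve (v r : ℝ) (x : ℤ → ℝ) (ω : Choices) : ℕ → ℤ → ℝ
  | 0 => x
  | t + 1 => fun i =>
      if ω (i, t) = true then min (evolve v r x ω t i + v) (evolve v r x ω t (i + 1) - 2 * r)
      else evolve v r x ω t i

/-- `c` is the average velocity at density `ρ` of the process with jump size `v`, jump
probability `p` and ball radius `r`: from every admissible initial configuration of density `ρ`,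
almost surely, `(x_i^t - x_i^0) / t → c` as `t → ∞` for every particle `i`. -/
def HasAverageVelocity (ρ : ℝ) (p : unitInterval) (v r c : ℝ) : Prop :=
  ∀ x : ℤ → ℝ, IsAdmissible r x → HasDensity x ρ →
    ∀ᵐ ω ∂(choiceLaw p), ∀ i : ℤ,
      Tendsto (fun t : ℕ => (evolve v r x ω t i - x i) / (t : ℝ)) atTop (𝓝 c)

/-- The average velocity `V(ρ, p, v, r)` is well defined: there are admissible configurations of
density `ρ`, and exactly one number is the average velocity at density `ρ`. -/
def VelocityWellDefined (ρ : ℝ) (p : unitInterval) (v r : ℝ) : Prop :=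
  (∃ x : ℤ → ℝ, IsAdmissible r x ∧ HasDensity x ρ) ∧ ∃! c : ℝ, HasAverageVelocity ρ p v r c

/-- The average velocity `V(ρ, p, v, r)`. It is meaningful when `VelocityWellDefined ρ p v r`
holds, and is then the only number `c` with `HasAverageVelocity ρ p v r c`. -/
noncomputable def averageVelocity (ρ : ℝ) (p : unitInterval) (v r : ℝ) : ℝ :=
  Classical.epsilon fun c : ℝ => HasAverageVelocity ρ p v r c

end ExclusionProcess

/-!
Removing the balls (`x i ↦ (x i - 2 r i) / v`) reduces every case to point particles with jump size
`1`, and a density to a slope `g`, the asymptotic mean gap. A particle only sees those ahead of it,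
so it suffices to follow particle `0` of the half-line process `halfEvolve`.

This dynamics is monotone and commutes with translations. A configuration of slope `g` therefore
stays, up to a bounded error, above any configuration of smaller slope and below any configuration
of larger slope (`ae_tendsto_of_hasSpeedAtSlope`). Hence it is enough to know, for slopes arbitrarily
close to `g` on either side, the velocity of one configuration.

For `p = 1` equally spaced particles are such configurations. For `p < 1` and `0 < q < p` they are
sampled from the stationary process. A gap is a queue in discrete time: the moves of the front
particle are the arrivals, those of the rear particle the departures. For the law `gapLaw p q`,
geometric apart from the mass at `0` and with mean `q (1 - q) / (p - q)`, Bernoulli arrivals of rate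
`q` give Bernoulli departures of rate `q` independent of the new queue (`map_queueStep`, the one-step
form of Burke's theorem). Iterating along the line, independent gaps with this law are stationary and
independent of the move of particle `0` (`map_gapStep`); iterating in time, the moves of particle
`0` are independent Bernoulli variables (`map_run`), to which the strong law of large numbers
applies. Fubini's theorem then provides a deterministic configuration with velocity `q`.

Solving `g = q (1 - q) / (p - q)` for `q` gives the explicit velocity `slopeVelocity g p`.
-/

namespace ExclusionProcess

/-! ### Product measures on sequences -/

section Sequences

variable {X : Type*} [MeasurableSpace X]

/-- The sequence with first term `a` followed by the terms of `u`. -/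
def consSeq {X : Type*} (a : X) (u : ℕ → X) : ℕ → X
  | 0 => a
  | n + 1 => u n

@[fun_prop]
theorem measurable_consSeq : Measurable fun z : X × (ℕ → X) => consSeq z.1 z.2 := by
  refine measurable_pi_lambda _ fun n => ?_
  cases n with
  | zero => exact measurable_fst
  | succ n => exact (measurable_pi_apply n).comp measurable_snd

/-- It suffices to test cylinders over an initial segment of `ℕ`. -/
theorem eq_infinitePi_of_prefix (μ : Measure X) [IsProbabilityMeasure μ] (ν : Measure (ℕ → X))
    (h : ∀ (k : ℕ) (t : ℕ → Set X), (∀ i, MeasurableSet (t i)) →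
      ν {x | ∀ i < k, x i ∈ t i} = ∏ i ∈ Finset.range k, μ (t i)) :
    ν = Measure.infinitePi fun _ => μ := by
  classical
  refine Measure.eq_infinitePi _ fun s t ht => ?_
  have hs : s ⊆ Finset.range (s.sup id + 1) := fun i hi =>
    Finset.mem_range.2 (Nat.lt_succ_of_le (Finset.le_sup (f := id) hi))
  have hk := h (s.sup id + 1) (fun i => if i ∈ s then t i else Set.univ) fun i => by
    split_ifs
    exacts [ht i, .univ]
  have hset : {x : ℕ → X | ∀ i < s.sup id + 1, x i ∈ if i ∈ s then t i else Set.univ} =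
      Set.pi s t := by
    ext x
    simp only [Set.mem_ofPred_eq, Set.mem_pi, Finset.mem_coe]
    refine ⟨fun hx i hi => ?_, fun hx i _ => ?_⟩
    · simpa [hi] using hx i (Finset.mem_range.1 (hs hi))
    · split_ifs with hi
      exacts [hx i hi, trivial]
  rw [hset] at hk
  rw [hk, ← Finset.prod_subset hs (fun i _ hi => by simp [hi])]
  exact Finset.prod_congr rfl fun i hi => by simp [hi]

theorem infinitePi_prefix (μ : Measure X) [IsProbabilityMeasure μ] (k : ℕ) (t : ℕ → Set X)
    (ht : ∀ i, MeasurableSet (t i)) :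
    Measure.infinitePi (fun _ : ℕ => μ) {x | ∀ i < k, x i ∈ t i} =
      ∏ i ∈ Finset.range k, μ (t i) := by
  rw [← Measure.infinitePi_pi (μ := fun _ : ℕ => μ) fun i _ => ht i]
  congr 1
  ext x
  simp

theorem measurableSet_prefix (k : ℕ) (t : ℕ → Set X) (ht : ∀ i, MeasurableSet (t i)) :
    MeasurableSet {x : ℕ → X | ∀ i < k, x i ∈ t i} := by
  simp only [Set.ofPred_forall]
  exact .iInter fun i => .iInter fun _ => measurable_pi_apply i (ht i)

theorem map_consSeq (μ : Measure X) [IsProbabilityMeasure μ] :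
    (μ.prod (Measure.infinitePi fun _ : ℕ => μ)).map (fun z => consSeq z.1 z.2) =
      Measure.infinitePi fun _ => μ := by
  refine eq_infinitePi_of_prefix _ _ fun k t ht => ?_
  rw [Measure.map_apply measurable_consSeq (measurableSet_prefix k t ht)]
  cases k with
  | zero => simp
  | succ k =>
    have : (fun z : X × (ℕ → X) => consSeq z.1 z.2) ⁻¹' {x | ∀ i < k + 1, x i ∈ t i} =
        t 0 ×ˢ {x | ∀ i < k, x i ∈ t (i + 1)} := by
      ext ⟨a, u⟩
      simp only [Set.mem_preimage, Set.mem_ofPred_eq, Set.mem_prod, Nat.forall_lt_succ_left']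
      rfl
    rw [this, Measure.prod_prod, infinitePi_prefix μ k _ fun i => ht (i + 1),
      Finset.prod_range_succ', mul_comm]

/-- The strong law of large numbers for the coordinates of a product measure. -/
theorem ae_tendsto_average (μ : Measure X) [IsProbabilityMeasure μ] (f : X → ℝ)
    (hf : Measurable f) (hi : Integrable f μ) :
    ∀ᵐ u ∂(Measure.infinitePi fun _ : ℕ => μ),
      Tendsto (fun n : ℕ => (∑ i ∈ Finset.range n, f (u i)) / n) atTop (𝓝 (∫ x, f x ∂μ)) := by
  have hmp (i : ℕ) : MeasurePreserving (Function.eval i)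
      (Measure.infinitePi fun _ : ℕ => μ) μ :=
    measurePreserving_eval_infinitePi (fun _ : ℕ => μ) i
  have h := strong_law_ae_real (μ := Measure.infinitePi fun _ : ℕ => μ) (fun i u => f (u i))
    ((hmp 0).integrable_comp_of_integrable hi)
    (fun i j hij => (iIndepFun_infinitePi (P := fun _ : ℕ => μ) (X := fun _ => f)
      fun _ => hf).indepFun hij)
    (fun i => ⟨(hf.comp (measurable_pi_apply i)).aemeasurable,
      (hf.comp (measurable_pi_apply 0)).aemeasurable, by
        rw [show (fun u : ℕ → X => f (u i)) = f ∘ Function.eval i from rfl,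
          show (fun u : ℕ → X => f (u 0)) = f ∘ Function.eval 0 from rfl,
          ← Measure.map_map hf (hmp i).measurable, ← Measure.map_map hf (hmp 0).measurable,
          (hmp i).map_eq, (hmp 0).map_eq]⟩)
  have hint : ∫ u, f (u 0) ∂(Measure.infinitePi fun _ : ℕ => μ) = ∫ x, f x ∂μ := by
    conv_rhs => rw [← (hmp 0).map_eq]
    rw [integral_map (hmp 0).measurable.aemeasurable hf.aestronglyMeasurable]
  rwa [hint] at h

end Sequences

/-! ### Automata driven by independent inputs -/

section Automaton

variable {A U O : Type*}

/-- The output sequence of the automaton which, in state `a` and on input `u`, emits the first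
component of `F (a, u)` and passes to the state given by the second. -/
def run (F : A × U → O × A) (a : A) (u : ℕ → U) : ℕ → O
  | 0 => (F (a, u 0)).1
  | s + 1 => run F (F (a, u 0)).2 (fun i => u (i + 1)) s

variable [MeasurableSpace A] [MeasurableSpace U] [MeasurableSpace O]

theorem measurable_run {F : A × U → O × A} (hF : Measurable F) :
    Measurable fun z : A × (ℕ → U) => run F z.1 z.2 := by
  refine measurable_pi_lambda _ fun s => ?_
  induction s with
  | zero =>
    change Measurable fun z : A × (ℕ → U) => (F (z.1, z.2 0)).1
    fun_prop
  | succ s ih =>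
    exact ih.comp (g := fun z : A × (ℕ → U) => run F z.1 z.2 s)
      (f := fun z : A × (ℕ → U) => ((F (z.1, z.2 0)).2, fun i => z.2 (i + 1))) (by fun_prop)

/-- If one step of the automaton turns independent state and input into independent output and
state, with the same law of the state, then the outputs are independent and identically
distributed. -/
theorem map_run {F : A × U → O × A} (hF : Measurable F) (α : Measure A) (μ : Measure U)
    (ο : Measure O) [IsProbabilityMeasure α] [IsProbabilityMeasure μ] [IsProbabilityMeasure ο]
    (h : (α.prod μ).map F = ο.prod α) :
    (α.prod (Measure.infinitePi fun _ : ℕ => μ)).map (fun z => run F z.1 z.2) =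
      Measure.infinitePi fun _ => ο := by
  refine eq_infinitePi_of_prefix _ _ fun k t ht => ?_
  rw [Measure.map_apply (measurable_run hF) (measurableSet_prefix k t ht)]
  induction k generalizing t with
  | zero => simp
  | succ k ih =>
    set P := Measure.infinitePi fun _ : ℕ => μ
    have hmeas := measurable_run hF (measurableSet_prefix (k + 1) t ht)
    have hmeas' := measurable_run hF (measurableSet_prefix k _ fun i => ht (i + 1))
    -- The first input is split off, and the first step of the automaton is performed.
    have hsplit : ((α.prod μ).prod P).map
        (fun z : (A × U) × (ℕ → U) => (z.1.1, consSeq z.1.2 z.2)) = α.prod P := by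
      rw [show (fun z : (A × U) × (ℕ → U) => (z.1.1, consSeq z.1.2 z.2)) =
          Prod.map id (fun z : U × (ℕ → U) => consSeq z.1 z.2) ∘ MeasurableEquiv.prodAssoc from rfl,
        ← Measure.map_map (by fun_prop) (by fun_prop), Measure.prodAssoc_prod,
        ← Measure.map_prod_map _ _ measurable_id measurable_consSeq, Measure.map_id, map_consSeq]
    have hstep : ((α.prod μ).prod P).map
        (fun z : (A × U) × (ℕ → U) => ((F z.1).1, (F z.1).2, z.2)) = ο.prod (α.prod P) := by
      rw [show (fun z : (A × U) × (ℕ → U) => ((F z.1).1, (F z.1).2, z.2)) =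
          MeasurableEquiv.prodAssoc ∘ Prod.map F id from rfl,
        ← Measure.map_map (by fun_prop) (by fun_prop),
        ← Measure.map_prod_map _ _ hF measurable_id, Measure.map_id, h, Measure.prodAssoc_prod]
    have hset : (fun z : (A × U) × (ℕ → U) => (z.1.1, consSeq z.1.2 z.2)) ⁻¹'
          ((fun z : A × (ℕ → U) => run F z.1 z.2) ⁻¹' {x | ∀ i < k + 1, x i ∈ t i}) =
        (fun z : (A × U) × (ℕ → U) => ((F z.1).1, (F z.1).2, z.2)) ⁻¹'
          (t 0 ×ˢ ((fun z : A × (ℕ → U) => run F z.1 z.2) ⁻¹'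
            {x | ∀ i < k, x i ∈ t (i + 1)})) := by
      ext ⟨⟨a, u⟩, us⟩
      simp only [Set.mem_preimage, Set.mem_ofPred_eq, Set.mem_prod, Nat.forall_lt_succ_left']
      rfl
    rw [← hsplit, Measure.map_apply (by fun_prop) hmeas, hset,
      ← Measure.map_apply (by fun_prop) ((ht 0).prod hmeas'), hstep, Measure.prod_prod,
      ih _ fun i => ht (i + 1), Finset.prod_range_succ', mul_comm]

end Automaton

/-! ### The stationary law of the gaps -/

section GapLaw

/-- The mass at `n` of the stationary law of a gap, for jump probability `p` and velocity `q`. -/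
noncomputable def gapWeight (p q : ℝ) : ℕ → ℝ
  | 0 => (p - q) / p
  | n + 1 => (p - q) / p * (q / (p * (1 - q))) * (q * (1 - p) / (p * (1 - q))) ^ n

/-- The stationary law of a gap: geometric apart from the mass at `0`. -/
noncomputable def gapLaw (p q : ℝ) : Measure ℕ :=
  Measure.sum fun n => ENNReal.ofReal (gapWeight p q n) • Measure.dirac n

variable {p q : ℝ}

theorem gapWeight_nonneg (hq : 0 < q) (hqp : q < p) (hp : p < 1) (n : ℕ) :
    0 ≤ gapWeight p q n := by
  have h1 : 0 < p := hq.trans hqp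
  have h2 : 0 < 1 - q := by linarith
  have h3 : 0 < 1 - p := by linarith
  have h4 : 0 < p - q := by linarith
  cases n <;> simp only [gapWeight] <;> positivity

theorem gapRatio_mem (hq : 0 < q) (hqp : q < p) (hp : p < 1) :
    0 ≤ q * (1 - p) / (p * (1 - q)) ∧ q * (1 - p) / (p * (1 - q)) < 1 := by
  have h1 : 0 < p := hq.trans hqp
  have h2 : 0 < 1 - q := by linarith
  have h3 : 0 < 1 - p := by linarith
  refine ⟨by positivity, (div_lt_one (by positivity)).2 (by nlinarith)⟩

theorem one_sub_gapRatio (hq : 0 < q) (hqp : q < p) (hp : p < 1) :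
    1 - q * (1 - p) / (p * (1 - q)) = (p - q) / (p * (1 - q)) := by
  have h1 : p ≠ 0 := (hq.trans hqp).ne'
  have h2 : 1 - q ≠ 0 := by linarith
  field_simp
  ring

theorem hasSum_gapWeight (hq : 0 < q) (hqp : q < p) (hp : p < 1) : HasSum (gapWeight p q) 1 := by
  have hr := gapRatio_mem hq hqp hp
  have h := ((hasSum_geometric_of_lt_one hr.1 hr.2).mul_left
    ((p - q) / p * (q / (p * (1 - q))))).zero_add (f := gapWeight p q)
  rw [one_sub_gapRatio hq hqp hp, gapWeight] at h
  have h1 : p ≠ 0 := (hq.trans hqp).ne'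
  have h2 : 1 - q ≠ 0 := by linarith
  have h3 : p - q ≠ 0 := by linarith
  rwa [show (p - q) / p + (p - q) / p * (q / (p * (1 - q))) * ((p - q) / (p * (1 - q)))⁻¹ = 1 by
    field_simp; ring] at h

theorem hasSum_gapWeight_mul (hq : 0 < q) (hqp : q < p) (hp : p < 1) :
    HasSum (fun n : ℕ => gapWeight p q n * n) (q * (1 - q) / (p - q)) := by
  have hr := gapRatio_mem hq hqp hp
  have hsum := (hasSum_choose_mul_geometric_of_norm_lt_one 1
    (r := q * (1 - p) / (p * (1 - q))) (by rw [Real.norm_of_nonneg hr.1]; exact hr.2)).mul_left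
      ((p - q) / p * (q / (p * (1 - q))))
  have h1 : p ≠ 0 := (hq.trans hqp).ne'
  have h2 : 1 - q ≠ 0 := by linarith
  have h3 : p - q ≠ 0 := by linarith
  rw [one_sub_gapRatio hq hqp hp,
    show (p - q) / p * (q / (p * (1 - q))) * (1 / ((p - q) / (p * (1 - q))) ^ (1 + 1)) =
      q * (1 - q) / (p - q) by rw [one_add_one_eq_two, div_pow]; field_simp,
    show (fun n : ℕ => (p - q) / p * (q / (p * (1 - q))) *
      (((n + 1).choose 1 : ℕ) * (q * (1 - p) / (p * (1 - q))) ^ n)) =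
      fun n : ℕ => gapWeight p q (n + 1) * ((n + 1 : ℕ) : ℝ) by
        ext n; simp only [gapWeight, Nat.choose_one_right]; ring] at hsum
  simpa using hsum.zero_add (f := fun n : ℕ => gapWeight p q n * n)

theorem isProbabilityMeasure_gapLaw (hq : 0 < q) (hqp : q < p) (hp : p < 1) :
    IsProbabilityMeasure (gapLaw p q) := by
  refine ⟨?_⟩
  have h := hasSum_gapWeight hq hqp hp
  rw [gapLaw, Measure.sum_apply _ .univ]
  simp only [Measure.smul_apply, measure_univ, smul_eq_mul, mul_one]
  rw [← ENNReal.ofReal_tsum_of_nonneg (gapWeight_nonneg hq hqp hp) h.summable, h.tsum_eq,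
    ENNReal.ofReal_one]

theorem gapLaw_real_singleton (hq : 0 < q) (hqp : q < p) (hp : p < 1) (n : ℕ) :
    (gapLaw p q).real {n} = gapWeight p q n := by
  rw [measureReal_def, gapLaw, Measure.sum_smul_dirac_singleton,
    ENNReal.toReal_ofReal (gapWeight_nonneg hq hqp hp n)]

theorem integrable_gapLaw (hq : 0 < q) (hqp : q < p) (hp : p < 1) :
    Integrable (fun n : ℕ => (n : ℝ)) (gapLaw p q) := by
  refine integrable_sum_dirac (fun _ => ENNReal.ofReal_ne_top) ?_
  simpa [ENNReal.toReal_ofReal (gapWeight_nonneg hq hqp hp _)]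
    using (hasSum_gapWeight_mul hq hqp hp).summable

theorem integral_gapLaw (hq : 0 < q) (hqp : q < p) (hp : p < 1) :
    ∫ n, (n : ℝ) ∂(gapLaw p q) = q * (1 - q) / (p - q) := by
  rw [integral_countable (integrable_gapLaw hq hqp hp)]
  simpa [gapLaw_real_singleton hq hqp hp] using (hasSum_gapWeight_mul hq hqp hp).tsum_eq

end GapLaw

/-! ### One time step of the gaps -/

/-- Whether a particle with gap `n` in front of it moves by one unit, if `w` says whether it
attempts to. -/
def jump (n : ℕ) (w : Bool) : Bool := w && decide (n ≠ 0)

/-- One step of a single gap `n`: the rear particle moves if `w` allows it, the front particle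
moves if `a` is true. Returned are the move of the rear particle and the new gap. In the language
of queues, `n` is the queue length, `w` the service, `a` the arrival, and the first component of
the result the departure. -/
def queueStep (z : (ℕ × Bool) × Bool) : Bool × ℕ :=
  (jump z.1.1 z.1.2, z.1.1 - (jump z.1.1 z.1.2).toNat + z.2.toNat)

theorem lintegral_bernoulli (p : unitInterval) (f : Bool → ENNReal) :
    ∫⁻ b, f b ∂(bernoulliMeasure true false p) =
      ENNReal.ofReal p * f true + ENNReal.ofReal (1 - p) * f false := by
  rw [bernoulliMeasure_def, lintegral_add_measure, lintegral_smul_measure, lintegral_smul_measure,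
    lintegral_dirac, lintegral_dirac, ENNReal.smul_def, ENNReal.smul_def, smul_eq_mul, smul_eq_mul]
  congr 2 <;> rw [ENNReal.ofReal, ENNReal.coe_inj] <;> ext <;> simp [p.2.1, p.2.2]

theorem prod_bernoulli_real {X : Type*} [MeasurableSpace X] (μ : Measure X) [IsFiniteMeasure μ]
    (p : unitInterval) {s : Set (X × Bool)} (hs : MeasurableSet s) :
    (μ.prod (bernoulliMeasure true false p)).real s =
      p * μ.real {x | (x, true) ∈ s} + (1 - p) * μ.real {x | (x, false) ∈ s} := by
  rw [measureReal_def, Measure.prod_apply_symm hs, lintegral_bernoulli, ENNReal.toReal_add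
    (ENNReal.mul_ne_top ENNReal.ofReal_ne_top (measure_ne_top _ _))
    (ENNReal.mul_ne_top ENNReal.ofReal_ne_top (measure_ne_top _ _)), ENNReal.toReal_mul,
    ENNReal.toReal_mul, ENNReal.toReal_ofReal p.2.1, ENNReal.toReal_ofReal (by linarith [p.2.2])]
  rfl

/-- Burke's theorem for one time step: if the gap has the stationary law and the front particle
moves with probability `q`, then the rear particle moves with probability `q`, independently of
the new gap, which again has the stationary law. -/
theorem map_queueStep {p q : unitInterval} (hq : 0 < (q : ℝ)) (hqp : (q : ℝ) < p)
    (hp : (p : ℝ) < 1) :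
    (((gapLaw p q).prod (bernoulliMeasure true false p)).prod (bernoulliMeasure true false q)).map
      queueStep = (bernoulliMeasure true false q).prod (gapLaw p q) := by
  have := isProbabilityMeasure_gapLaw hq hqp hp
  have hmeas : Measurable queueStep := measurable_of_countable _
  have := Measure.isProbabilityMeasure_map (μ := ((gapLaw p q).prod
    (bernoulliMeasure true false p)).prod (bernoulliMeasure true false q)) hmeas.aemeasurable
  have h1 : (p : ℝ) ≠ 0 := (hq.trans hqp).ne'
  have h2 : 1 - (q : ℝ) ≠ 0 := by linarith
  refine ext_iff_measureReal_singleton.2 fun ⟨b, m⟩ => ?_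
  rw [map_measureReal_apply hmeas (.singleton _),
    prod_bernoulli_real _ _ (hmeas (.singleton _)), prod_bernoulli_real _ _ (.of_discrete),
    prod_bernoulli_real _ _ (.of_discrete), ← Set.singleton_prod_singleton, measureReal_prod_prod,
    gapLaw_real_singleton hq hqp hp]
  have hset (w a b : Bool) (m k : ℕ) (h : ∀ n, queueStep ((n, w), a) = (b, m) ↔ n = k) :
      (gapLaw p q).real {n | queueStep ((n, w), a) = (b, m)} = gapWeight p q k := by
    rw [← gapLaw_real_singleton hq hqp hp]
    congr 1
    ext n
    exact h n
  have hempty (w a b : Bool) (m : ℕ) (h : ∀ n, queueStep ((n, w), a) ≠ (b, m)) :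
      (gapLaw p q).real {n | queueStep ((n, w), a) = (b, m)} = 0 := by
    simp [h]
  have ht : (bernoulliMeasure true false q).real {true} = q := by simp
  have hf : (bernoulliMeasure true false q).real {false} = 1 - q := by simp
  simp only [Set.mem_preimage, Set.singleton_prod_singleton, Set.mem_singleton_iff,
    Set.mem_ofPred_eq]
  cases b with
  | true =>
    rw [ht, hempty false true true m fun n => by simp [queueStep, jump],
      hempty false false true m fun n => by simp [queueStep, jump],
      hset true false true m (m + 1) fun n => by cases n <;> simp [queueStep, jump]]
    cases m with
    | zero =>
      rw [hempty true true true 0 fun n => by simp [queueStep, jump]]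
      simp only [gapWeight]
      field_simp
      ring
    | succ m =>
      rw [hset true true true (m + 1) (m + 1) fun n => by cases n <;> simp [queueStep, jump]]
      simp only [gapWeight, pow_succ]
      generalize ((q : ℝ) * (1 - p) / (p * (1 - q))) ^ m = c
      field_simp
      ring
  | false =>
    rw [hf, hset false false false m m fun n => by simp [queueStep, jump]]
    match m with
    | 0 =>
      rw [hempty true true false 0 fun n => by simp [queueStep, jump],
        hset true false false 0 0 fun n => by simp +contextual [queueStep, jump],
        hempty false true false 0 fun n => by simp [queueStep, jump]]
      simp only [gapWeight]
      field_simp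
      ring
    | 1 =>
      rw [hset true true false 1 0 fun n => by simp +contextual [queueStep, jump],
        hempty true false false 1 fun n => by simp +contextual [queueStep, jump],
        hset false true false 1 0 fun n => by simp [queueStep, jump]]
      simp only [gapWeight]
      field_simp
      ring
    | m + 2 =>
      rw [hempty true true false (m + 2) fun n => by simp +contextual [queueStep, jump],
        hempty true false false (m + 2) fun n => by simp +contextual [queueStep, jump],
        hset false true false (m + 2) (m + 1) fun n => by simp [queueStep, jump]]
      simp only [gapWeight, pow_succ]
      generalize ((q : ℝ) * (1 - p) / (p * (1 - q))) ^ m = c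
      field_simp
      ring

/-- If the gap has the stationary law, then the rear particle moves with probability `q`. -/
theorem map_jump {p q : unitInterval} (hq : 0 < (q : ℝ)) (hqp : (q : ℝ) < p)
    (hp : (p : ℝ) < 1) :
    ((gapLaw p q).prod (bernoulliMeasure true false p)).map (fun z => jump z.1 z.2) =
      bernoulliMeasure true false q := by
  have := isProbabilityMeasure_gapLaw hq hqp hp
  have h := congrArg (Measure.map Prod.fst) (map_queueStep hq hqp hp)
  rw [Measure.map_map measurable_fst (measurable_of_countable _)] at h
  have h' : (Measure.map Prod.fst ((bernoulliMeasure true false q).prod (gapLaw p q))) =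
      bernoulliMeasure true false q := by simp
  rw [h', show Prod.fst ∘ queueStep = (fun z : ℕ × Bool => jump z.1 z.2) ∘ Prod.fst from rfl,
    ← Measure.map_map (measurable_of_countable _) measurable_fst] at h
  simpa using h

/-- One time step of all gaps: whether the first particle moves, and the new gaps. -/
def gapStep (z : (ℕ → ℕ) × (ℕ → Bool)) : Bool × (ℕ → ℕ) :=
  (jump (z.1 0) (z.2 0),
    fun i => (queueStep ((z.1 i, z.2 i), jump (z.1 (i + 1)) (z.2 (i + 1)))).2)

theorem measurable_gapStep : Measurable gapStep := by
  have hq : Measurable queueStep := measurable_of_countable _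
  have hj : Measurable fun z : ℕ × Bool => jump z.1 z.2 := measurable_of_countable _
  have hj' (i : ℕ) : Measurable fun z : (ℕ → ℕ) × (ℕ → Bool) => jump (z.1 i) (z.2 i) :=
    hj.comp (f := fun z : (ℕ → ℕ) × (ℕ → Bool) => (z.1 i, z.2 i)) (by fun_prop)
  refine (hj' 0).prodMk (measurable_pi_lambda _ fun i => measurable_snd.comp (hq.comp ?_))
  exact Measurable.prodMk (by fun_prop) (hj' (i + 1))

theorem measurePreserving_prodAssoc {A B C : Type*} [MeasurableSpace A] [MeasurableSpace B]
    [MeasurableSpace C] (μ : Measure A) (ν : Measure B) (ρ : Measure C) [SFinite μ] [SFinite ν]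
    [SFinite ρ] :
    MeasurePreserving MeasurableEquiv.prodAssoc ((μ.prod ν).prod ρ) (μ.prod (ν.prod ρ)) :=
  ⟨MeasurableEquiv.measurable _, Measure.prodAssoc_prod⟩

theorem map_prodProdProdComm {A B C D : Type*} [MeasurableSpace A] [MeasurableSpace B]
    [MeasurableSpace C] [MeasurableSpace D] (μ : Measure A) (ν : Measure B) (ρ : Measure C)
    (σ : Measure D) [SFinite μ] [SFinite ν] [SFinite ρ] [SFinite σ] :
    ((μ.prod ν).prod (ρ.prod σ)).map (fun z => ((z.1.1, z.2.1), (z.1.2, z.2.2))) =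
      (μ.prod ρ).prod (ν.prod σ) := by
  have h1 := measurePreserving_prodAssoc μ ν (ρ.prod σ)
  have h2 := (measurePreserving_prodAssoc ν ρ σ).symm
  have h3 := (Measure.measurePreserving_swap (μ := ν) (ν := ρ)).prod (MeasurePreserving.id σ)
  have h4 := measurePreserving_prodAssoc ρ ν σ
  have h5 := (measurePreserving_prodAssoc μ ρ (ν.prod σ)).symm
  exact (h5.comp (((MeasurePreserving.id μ).prod (h4.comp (h3.comp h2))).comp h1)).map_eq

theorem map_prod_consSeq {X Y : Type*} [MeasurableSpace X] [MeasurableSpace Y] (μ : Measure X)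
    (ν : Measure Y) [IsProbabilityMeasure μ] [IsProbabilityMeasure ν] :
    ((μ.prod ν).prod ((Measure.infinitePi fun _ : ℕ => μ).prod
      (Measure.infinitePi fun _ : ℕ => ν))).map
        (fun z => (consSeq z.1.1 z.2.1, consSeq z.1.2 z.2.2)) =
      (Measure.infinitePi fun _ : ℕ => μ).prod (Measure.infinitePi fun _ : ℕ => ν) := by
  conv_rhs => rw [← map_consSeq μ, ← map_consSeq ν,
    Measure.map_prod_map _ _ measurable_consSeq measurable_consSeq, ← map_prodProdProdComm,
    Measure.map_map (by fun_prop) (by fun_prop)]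
  rfl

/-- Independent gaps with the stationary law are stationary, and the first particle then moves
with probability `q`, independently of the new gaps. -/
theorem map_gapStep {p q : unitInterval} (hq : 0 < (q : ℝ)) (hqp : (q : ℝ) < p)
    (hp : (p : ℝ) < 1) :
    ((Measure.infinitePi fun _ : ℕ => gapLaw p q).prod
      (Measure.infinitePi fun _ : ℕ => bernoulliMeasure true false p)).map gapStep =
      (bernoulliMeasure true false q).prod (Measure.infinitePi fun _ : ℕ => gapLaw p q) := by
  have := isProbabilityMeasure_gapLaw hq hqp hp
  set π := gapLaw p q
  set β := bernoulliMeasure true false p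
  set P := (Measure.infinitePi fun _ : ℕ => π).prod (Measure.infinitePi fun _ : ℕ => β) with hP
  have hbox (k : ℕ) (B : Set Bool) (t : ℕ → Set ℕ) :
      P (gapStep ⁻¹' (B ×ˢ {x | ∀ i < k, x i ∈ t i})) =
        bernoulliMeasure true false q B * ∏ i ∈ Finset.range k, π (t i) := by
    have hT (k : ℕ) (t : ℕ → Set ℕ) : MeasurableSet {x : ℕ → ℕ | ∀ i < k, x i ∈ t i} :=
      measurableSet_prefix k t fun i => .of_discrete
    have hcons : Measurable fun z : (ℕ × Bool) × ((ℕ → ℕ) × (ℕ → Bool)) =>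
        (consSeq z.1.1 z.2.1, consSeq z.1.2 z.2.2) :=
      (measurable_consSeq.comp (f := fun z : (ℕ × Bool) × ((ℕ → ℕ) × (ℕ → Bool)) =>
        (z.1.1, z.2.1)) (by fun_prop)).prodMk
      (measurable_consSeq.comp (f := fun z : (ℕ × Bool) × ((ℕ → ℕ) × (ℕ → Bool)) =>
        (z.1.2, z.2.2)) (by fun_prop))
    rw [hP, ← map_prod_consSeq, ← hP, Measure.map_apply hcons
      (measurable_gapStep (MeasurableSet.prod .of_discrete (hT k t)))]
    induction k generalizing B t with
    | zero =>
      rw [← map_jump hq hqp hp, Measure.map_apply (measurable_of_countable _) .of_discrete,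
        Finset.prod_range_zero, mul_one, ← mul_one ((π.prod β) _), ← measure_univ (μ := P),
        ← Measure.prod_prod]
      congr 1
      ext z
      simp [gapStep, consSeq]
    | succ k ih =>
      have ih' (B : Set Bool) : P (gapStep ⁻¹' (B ×ˢ {x | ∀ i < k, x i ∈ t (i + 1)})) =
          bernoulliMeasure true false q B * ∏ i ∈ Finset.range k, π (t (i + 1)) := by
        rw [← ih B fun i => t (i + 1), ← Measure.map_apply hcons
          (measurable_gapStep (MeasurableSet.prod .of_discrete (hT k _))), map_prod_consSeq]
      -- Restricted to the event prescribing the later gaps, the move of the second particle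
      -- still has a law proportional to the Bernoulli law.
      set E : Set ((ℕ → ℕ) × (ℕ → Bool)) :=
        {z | ∀ i < k, (gapStep z).2 i ∈ t (i + 1)} with hE
      have hEm : MeasurableSet E := measurable_gapStep.snd (hT k fun i => t (i + 1))
      have hJ : (P.restrict E).map (fun z => (gapStep z).1) =
          (∏ i ∈ Finset.range k, π (t (i + 1))) • bernoulliMeasure true false q := by
        ext B hB
        rw [Measure.map_apply measurable_gapStep.fst hB,
          Measure.restrict_apply (measurable_gapStep.fst hB), Measure.smul_apply, smul_eq_mul,
          mul_comm, ← ih' B]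
        rfl
      have hset : (fun z : (ℕ × Bool) × ((ℕ → ℕ) × (ℕ → Bool)) =>
          (consSeq z.1.1 z.2.1, consSeq z.1.2 z.2.2)) ⁻¹'
            (gapStep ⁻¹' (B ×ˢ {x | ∀ i < k + 1, x i ∈ t i})) =
          (Prod.map id fun z => (gapStep z).1) ⁻¹' (queueStep ⁻¹' (B ×ˢ t 0)) ∩
            Set.univ ×ˢ E := by
        ext ⟨⟨n, w⟩, N, W⟩
        simp only [hE, Set.mem_preimage, Set.mem_prod, Set.mem_inter_iff, Set.mem_ofPred_eq,
          Nat.forall_lt_succ_left', Set.mem_univ, true_and]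
        exact and_assoc.symm
      have hm : Measurable (Prod.map id fun z : (ℕ → ℕ) × (ℕ → Bool) => (gapStep z).1 :
          (ℕ × Bool) × ((ℕ → ℕ) × (ℕ → Bool)) → (ℕ × Bool) × Bool) :=
        measurable_id.prodMap measurable_gapStep.fst
      have hQ : MeasurableSet (queueStep ⁻¹' (B ×ˢ t 0)) := .of_discrete
      rw [hset, ← Measure.restrict_apply (hm hQ), ← Measure.prod_restrict, Measure.restrict_univ,
        ← Measure.map_apply hm hQ, ← Measure.map_prod_map _ _ measurable_id measurable_gapStep.fst,
        Measure.map_id, hJ, Measure.prod_smul_right, Measure.smul_apply,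
        ← Measure.map_apply (measurable_of_countable _) .of_discrete, map_queueStep hq hqp hp,
        Measure.prod_prod, Finset.prod_range_succ', smul_eq_mul]
      ring
  refine (Measure.prod_eq fun B S hB hS => ?_).symm
  -- For fixed `B`, both sides are finite measures on sequences; normalized, they are compared on
  -- cylinders.
  have hsnd (S : Set (ℕ → ℕ)) (hS : MeasurableSet S) :
      ((P.map gapStep).restrict (B ×ˢ Set.univ)).map Prod.snd S = P (gapStep ⁻¹' (B ×ˢ S)) := by
    rw [Measure.map_apply measurable_snd hS, Measure.restrict_apply (measurable_snd hS),
      Measure.map_apply measurable_gapStep ((measurable_snd hS).inter (hB.prod .univ))]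
    congr 2
    ext ⟨b, x⟩
    simp [and_comm]
  rw [Measure.map_apply measurable_gapStep (hB.prod hS)]
  by_cases hB0 : bernoulliMeasure true false q B = 0
  · rw [hB0, zero_mul]
    refine measure_mono_null (Set.preimage_mono (Set.prod_mono subset_rfl fun x _ => ?_))
      ((hbox 0 B fun _ => Set.univ).trans (by rw [hB0, zero_mul]))
    simp
  have hν := eq_infinitePi_of_prefix π ((bernoulliMeasure true false q B)⁻¹ •
    ((P.map gapStep).restrict (B ×ˢ Set.univ)).map Prod.snd) fun k t ht => by
      rw [Measure.smul_apply, hsnd _ (measurableSet_prefix k t ht), hbox, smul_eq_mul, ← mul_assoc,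
        ENNReal.inv_mul_cancel hB0 (measure_ne_top _ _), one_mul]
  rw [← hν, Measure.smul_apply, hsnd S hS, smul_eq_mul, ← mul_assoc,
    ENNReal.mul_inv_cancel hB0 (measure_ne_top _ _), one_mul]

/-! ### The dynamics on a half-line -/

/-- One time step, with jump size `1` and radius `0`, of the particles with index `j ≥ 0`. -/
noncomputable def halfStep (y : ℕ → ℝ) (w : ℕ → Bool) : ℕ → ℝ := fun j =>
  if w j = true then min (y j + 1) (y (j + 1)) else y j

/-- The configuration at time `t` of the particles with index `j ≥ 0`, with jump size `1` and
radius `0`, started from `y`; `η s j` says whether particle `j` attempts to move between the times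
`s` and `s + 1`. The recursion peels off the first time step. -/
noncomputable def halfEvolve : ℕ → (ℕ → ℝ) → (ℕ → ℕ → Bool) → ℕ → ℝ
  | 0, y, _ => y
  | t + 1, y, η => halfEvolve t (halfStep y (η 0)) fun s => η (s + 1)

theorem halfEvolve_succ (t : ℕ) (y : ℕ → ℝ) (η : ℕ → ℕ → Bool) :
    halfEvolve (t + 1) y η = halfStep (halfEvolve t y η) (η t) := by
  induction t generalizing y η with
  | zero => rfl
  | succ t ih => exact ih (halfStep y (η 0)) fun s => η (s + 1)

/-- A particle only sees the particles ahead of it, and passing from the centres to the free space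
between the balls, in units of `v`, reduces to jump size `1` and radius `0`. -/
theorem evolve_eq_halfEvolve {v : ℝ} (hv : 0 < v) (r : ℝ) (x : ℤ → ℝ) (ω : Choices) (i : ℤ)
    (t j : ℕ) :
    evolve v r x ω t (i + j) =
      v * halfEvolve t (fun j : ℕ => (x (i + j) - 2 * r * j) / v)
        (fun s (j : ℕ) => ω (i + j, s)) j + 2 * r * j := by
  induction t generalizing j with
  | zero =>
    simp only [evolve, halfEvolve]
    field_simp
    ring
  | succ t ih =>
    have h := ih (j + 1)
    push_cast at h
    rw [← add_assoc] at h
    rw [halfEvolve_succ]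
    simp only [evolve, halfStep]
    split_ifs
    · rw [ih, h, mul_min_of_nonneg _ _ hv.le, ← min_add_add_right]
      congr 1 <;> ring
    · exact ih j

theorem halfEvolve_mono {y y' : ℕ → ℝ} (h : ∀ j, y j ≤ y' j) (t : ℕ) (η : ℕ → ℕ → Bool) (j : ℕ) :
    halfEvolve t y η j ≤ halfEvolve t y' η j := by
  induction t generalizing j with
  | zero => exact h j
  | succ t ih =>
    rw [halfEvolve_succ, halfEvolve_succ]
    simp only [halfStep]
    split_ifs
    · exact min_le_min (by linarith [ih j]) (ih _)
    · exact ih j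

theorem halfEvolve_add_const (y : ℕ → ℝ) (c : ℝ) (t : ℕ) (η : ℕ → ℕ → Bool) (j : ℕ) :
    halfEvolve t (fun j => y j + c) η j = halfEvolve t y η j + c := by
  induction t generalizing j with
  | zero => rfl
  | succ t ih =>
    rw [halfEvolve_succ, halfEvolve_succ]
    simp only [halfStep, ih]
    split_ifs
    · rw [← min_add_add_right, add_right_comm]
    · rfl

theorem halfStep_eq_add_jump {y : ℕ → ℝ} {N : ℕ → ℕ} (h : ∀ j, y (j + 1) = y j + N j)
    (w : ℕ → Bool) (j : ℕ) : halfStep y w j = y j + (jump (N j) (w j)).toNat := by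
  simp only [halfStep, jump, h]
  rcases w j with _ | _
  · simp
  · rcases Nat.eq_zero_or_pos (N j) with h0 | h0
    · simp [h0]
    · have : (1 : ℝ) ≤ N j := by exact_mod_cast h0
      simp [h0.ne', this]

/-- For integer gaps, the first particle advances by the number of outputs `true` of the
automaton of the gaps. -/
theorem halfEvolve_eq_sum_run {y : ℕ → ℝ} {N : ℕ → ℕ} (h : ∀ j, y (j + 1) = y j + N j) (t : ℕ)
    (η : ℕ → ℕ → Bool) :
    halfEvolve t y η 0 = y 0 + ∑ s ∈ Finset.range t, ((run gapStep N η s).toNat : ℝ) := by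
  induction t generalizing y N η with
  | zero => simp [halfEvolve]
  | succ t ih =>
    have hN : ∀ j, halfStep y (η 0) (j + 1) =
        halfStep y (η 0) j + ((gapStep (N, η 0)).2 j : ℕ) := by
      intro j
      have hle : (jump (N j) (η 0 j)).toNat ≤ N j := by
        rcases N j with _ | n
        · simp [jump]
        · exact (Bool.toNat_le _).trans (by omega)
      rw [halfStep_eq_add_jump h, halfStep_eq_add_jump h, h]
      simp only [gapStep, queueStep]
      push_cast [Nat.cast_sub hle]
      ring
    rw [halfEvolve, ih hN, halfStep_eq_add_jump h, Finset.sum_range_succ']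
    simp only [run, gapStep]
    ring

/-! ### Comparison of configurations with different slopes -/

/-- The law of the choices of the particles with index `j ≥ 0`, grouped by time. -/
noncomputable def rowLaw (p : unitInterval) : Measure (ℕ → ℕ → Bool) :=
  Measure.infinitePi fun _ => Measure.infinitePi fun _ => bernoulliMeasure true false p

/-- Some configuration of slope `g` has almost surely velocity `c`. -/
def HasSpeedAtSlope (p : unitInterval) (g c : ℝ) : Prop :=
  ∃ y : ℕ → ℝ, Tendsto (fun n : ℕ => y n / n) atTop (𝓝 g) ∧
    ∀ᵐ η ∂(rowLaw p), Tendsto (fun t : ℕ => halfEvolve t y η 0 / t) atTop (𝓝 c)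

theorem exists_le_add_of_slope_lt {y y' : ℕ → ℝ} {g g' : ℝ}
    (hy : Tendsto (fun n : ℕ => y n / n) atTop (𝓝 g))
    (hy' : Tendsto (fun n : ℕ => y' n / n) atTop (𝓝 g')) (hg : g < g') :
    ∃ C, ∀ n, y n ≤ y' n + C := by
  have h : ∀ᶠ n : ℕ in atTop, y n - y' n ≤ 0 := by
    filter_upwards [hy.eventually_lt hy' hg, eventually_gt_atTop 0] with n hn hn0
    have : (0 : ℝ) < n := by exact_mod_cast hn0
    linarith [(div_lt_div_iff_of_pos_right this).1 hn]
  obtain ⟨C, hC⟩ := (isBoundedUnder_of_eventually_le h).bddAbove_range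
  exact ⟨C, fun n => by linarith [hC (Set.mem_range_self n)]⟩

theorem halfEvolve_div_le {y y' : ℕ → ℝ} {C : ℝ} (h : ∀ n, y n ≤ y' n + C) (t : ℕ)
    (η : ℕ → ℕ → Bool) :
    halfEvolve t y η 0 / t ≤ halfEvolve t y' η 0 / t + C / t := by
  rw [← add_div, ← halfEvolve_add_const]
  exact div_le_div_of_nonneg_right (halfEvolve_mono h t η 0) t.cast_nonneg

/-- Monotonicity of the dynamics: if arbitrarily close to `g`, on either side, there are slopes at
which a single configuration has velocity close to `V`, then every configuration of slope `g` has
velocity `V`. -/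
theorem ae_tendsto_of_hasSpeedAtSlope {p : unitInterval} {g V : ℝ}
    (hlow : ∀ a < V, ∃ g' < g, ∃ c > a, HasSpeedAtSlope p g' c)
    (hup : ∀ a > V, ∃ g' > g, ∃ c < a, HasSpeedAtSlope p g' c)
    {y : ℕ → ℝ} (hy : Tendsto (fun n : ℕ => y n / n) atTop (𝓝 g)) :
    ∀ᵐ η ∂(rowLaw p), Tendsto (fun t : ℕ => halfEvolve t y η 0 / t) atTop (𝓝 V) := by
  have hC (C : ℝ) : Tendsto (fun t : ℕ => C / (t : ℝ)) atTop (𝓝 0) :=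
    tendsto_const_div_atTop_nhds_zero_nat C
  have hl (a : ℝ) (ha : a < V) : ∀ᵐ η ∂(rowLaw p), ∀ᶠ t : ℕ in atTop,
      a < halfEvolve t y η 0 / t := by
    obtain ⟨g', hg', c, hc, y', hy', hs⟩ := hlow a ha
    obtain ⟨C, h⟩ := exists_le_add_of_slope_lt hy' hy hg'
    filter_upwards [hs] with η hη
    have hlim := hη.sub (hC C)
    rw [sub_zero] at hlim
    filter_upwards [hlim.eventually_const_lt hc] with t ht
    linarith [halfEvolve_div_le h t η]
  have hu (a : ℝ) (ha : V < a) : ∀ᵐ η ∂(rowLaw p), ∀ᶠ t : ℕ in atTop,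
      halfEvolve t y η 0 / t < a := by
    obtain ⟨g', hg', c, hc, y', hy', hs⟩ := hup a ha
    obtain ⟨C, h⟩ := exists_le_add_of_slope_lt hy hy' hg'
    filter_upwards [hs] with η hη
    have hlim := hη.add (hC C)
    rw [add_zero] at hlim
    filter_upwards [hlim.eventually_lt_const hc] with t ht
    linarith [halfEvolve_div_le h t η]
  have hl' := ae_all_iff.2 fun k : ℕ => hl (V - 1 / (k + 1)) (by
    have : 0 < 1 / ((k : ℝ) + 1) := by positivity
    linarith)
  have hu' := ae_all_iff.2 fun k : ℕ => hu (V + 1 / (k + 1)) (by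
    have : 0 < 1 / ((k : ℝ) + 1) := by positivity
    linarith)
  filter_upwards [hl', hu'] with η hηl hηu
  refine tendsto_order.2 ⟨fun a ha => ?_, fun a ha => ?_⟩
  · obtain ⟨k, hk⟩ := exists_nat_one_div_lt (sub_pos.2 ha)
    exact (hηl k).mono fun t ht => by linarith
  · obtain ⟨k, hk⟩ := exists_nat_one_div_lt (sub_pos.2 ha)
    exact (hηu k).mono fun t ht => by linarith

/-! ### Configurations with known velocity -/

theorem hasSpeedAtSlope_one (g : ℝ) : HasSpeedAtSlope 1 g (min 1 g) := by
  have hstep (t j : ℕ) : halfEvolve t (fun j => g * j) (fun _ _ => true) j =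
      g * j + t * min 1 g := by
    induction t generalizing j with
    | zero => simp [halfEvolve]
    | succ t ih =>
      rw [halfEvolve_succ]
      simp only [halfStep, ih, if_true]
      push_cast
      rw [show g * ((j : ℝ) + 1) + t * min 1 g = g * j + t * min 1 g + g by ring, min_add_add_left]
      ring
  have hlim (c : ℝ) : Tendsto (fun t : ℕ => c * (t : ℝ) / t) atTop (𝓝 c) :=
    tendsto_const_nhds.congr' ((eventually_gt_atTop 0).mono fun t ht =>
      (mul_div_cancel_right₀ c (by positivity)).symm)
  refine ⟨fun j => g * j, hlim g, ?_⟩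
  simp only [rowLaw, bernoulliMeasure_one, Measure.infinitePi_dirac]
  rw [ae_dirac_eq, eventually_pure]
  simpa [hstep, mul_comm] using hlim (min 1 g)

/-- The stationary process: independent gaps with the stationary law have mean
`q (1 - q) / (p - q)`, and the moves of the first particle are independent with probability `q`. -/
theorem hasSpeedAtSlope_of_lt {p q : unitInterval} (hq : 0 < (q : ℝ)) (hqp : (q : ℝ) < p)
    (hp : (p : ℝ) < 1) : HasSpeedAtSlope p (q * (1 - q) / (p - q)) q := by
  have := isProbabilityMeasure_gapLaw hq hqp hp
  have hrun := map_run measurable_gapStep _ _ _ (map_gapStep hq hqp hp)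
  have hout := ae_tendsto_average (bernoulliMeasure true false q) (fun b => (b.toNat : ℝ))
    (measurable_of_countable _) (integrable_bernoulliMeasure _ _ _ _)
  rw [integral_bernoulliMeasure, ← hrun] at hout
  have hspeed := Measure.ae_ae_of_ae_prod
    (ae_of_ae_map (measurable_run measurable_gapStep).aemeasurable hout)
  have hslope := ae_tendsto_average (gapLaw p q) (fun n => (n : ℝ)) (measurable_of_countable _)
    (integrable_gapLaw hq hqp hp)
  rw [integral_gapLaw hq hqp hp] at hslope
  obtain ⟨N, hN, hη⟩ := (hslope.and hspeed).exists
  refine ⟨fun j => ∑ i ∈ Finset.range j, (N i : ℝ), hN, ?_⟩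
  filter_upwards [hη] with η h
  simpa [halfEvolve_eq_sum_run (y := fun j => ∑ i ∈ Finset.range j, (N i : ℝ))
    fun j => Finset.sum_range_succ _ _] using h

/-! ### The velocity as a function of the slope -/

/-- The velocity at slope `g` of point particles with jump size `1`: the smaller root of
`q ^ 2 - (1 + g) q + g p`. -/
noncomputable def slopeVelocity (g p : ℝ) : ℝ := (1 + g - √((1 + g) ^ 2 - 4 * p * g)) / 2

theorem slopeVelocity_one (g : ℝ) : slopeVelocity g 1 = min 1 g := by
  rw [slopeVelocity, show (1 + g) ^ 2 - 4 * 1 * g = (1 - g) ^ 2 by ring, Real.sqrt_sq_eq_abs]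
  rcases le_total 1 g with h | h
  · rw [min_eq_left h, abs_of_nonpos (by linarith)]
    ring
  · rw [min_eq_right h, abs_of_nonneg (by linarith)]
    ring

theorem slopeVelocity_spec {g p : ℝ} (hg : 0 < g) (hp0 : 0 < p) (hp : p < 1) :
    0 < slopeVelocity g p ∧ slopeVelocity g p < p ∧ p < 1 + g - slopeVelocity g p ∧
      slopeVelocity g p * (1 + g - slopeVelocity g p) = g * p := by
  have hgp : 0 < g * p := mul_pos hg hp0
  have hD : 0 ≤ (1 + g) ^ 2 - 4 * p * g := by nlinarith [sq_nonneg (1 - g)]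
  have h1 : √((1 + g) ^ 2 - 4 * p * g) < 1 + g := by
    rw [Real.sqrt_lt' (by linarith)]
    linarith
  have h2 : 1 + g - 2 * p < √((1 + g) ^ 2 - 4 * p * g) :=
    Real.lt_sqrt_of_sq_lt (by nlinarith)
  have h3 : 2 * p - (1 + g) < √((1 + g) ^ 2 - 4 * p * g) :=
    Real.lt_sqrt_of_sq_lt (by nlinarith)
  have h4 := Real.sq_sqrt hD
  refine ⟨?_, ?_, ?_, ?_⟩ <;> rw [slopeVelocity]
  · linarith
  · linarith
  · linarith
  · linear_combination (-1 / 4) * h4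

theorem ae_tendsto_slopeVelocity {p : unitInterval} (hp : 0 < p) {g : ℝ} (hg : 0 < g)
    {y : ℕ → ℝ} (hy : Tendsto (fun n : ℕ => y n / n) atTop (𝓝 g)) :
    ∀ᵐ η ∂(rowLaw p),
      Tendsto (fun t : ℕ => halfEvolve t y η 0 / t) atTop (𝓝 (slopeVelocity g p)) := by
  have hp0 : 0 < (p : ℝ) := hp
  rcases eq_or_ne p 1 with rfl | hp1
  · refine ae_tendsto_of_hasSpeedAtSlope (fun a ha => ?_) (fun a ha => ?_) hy <;>
      rw [Set.Icc.coe_one, slopeVelocity_one] at ha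
    · have ha' := lt_min_iff.1 ha
      exact ⟨(a + g) / 2, by linarith, _, lt_min ha'.1 (by linarith), hasSpeedAtSlope_one _⟩
    · rcases min_lt_iff.1 ha with h | h
      · exact ⟨g + 1, by linarith, _, (min_le_left _ _).trans_lt h, hasSpeedAtSlope_one _⟩
      · exact ⟨(a + g) / 2, by linarith, _, (min_le_right _ _).trans_lt (by linarith),
          hasSpeedAtSlope_one _⟩
  have hp1' : (p : ℝ) < 1 := lt_of_le_of_ne p.2.2 fun h => hp1 (Subtype.ext h)
  obtain ⟨hU0, hUp, hU2, hU⟩ := slopeVelocity_spec hg hp0 hp1'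
  set U := slopeVelocity g p
  -- The slopes at which the stationary process has velocity `q < U`, or `q > U`, lie below, or
  -- above, `g`, because `U` and `1 + g - U` are the roots of `q ^ 2 - (1 + g) q + g p`.
  refine ae_tendsto_of_hasSpeedAtSlope (fun a ha => ?_) (fun a ha => ?_) hy
  · obtain ⟨q, hq1, hqU⟩ := exists_between (max_lt ha hU0)
    obtain ⟨hqa, hq0⟩ := max_lt_iff.1 hq1
    have hqp := hqU.trans hUp
    refine ⟨q * (1 - q) / (p - q), ?_, q, hqa,
      hasSpeedAtSlope_of_lt (q := ⟨q, hq0.le, by linarith⟩) hq0 hqp hp1'⟩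
    rw [div_lt_iff₀ (by linarith)]
    nlinarith [mul_pos (sub_pos.2 hqU) (show 0 < 1 + g - U - q by linarith)]
  · obtain ⟨q, hUq, hq1⟩ := exists_between (lt_min ha hUp)
    obtain ⟨hqa, hqp⟩ := lt_min_iff.1 hq1
    have hq0 := hU0.trans hUq
    refine ⟨q * (1 - q) / (p - q), ?_, q, hqa,
      hasSpeedAtSlope_of_lt (q := ⟨q, hq0.le, by linarith⟩) hq0 hqp hp1'⟩
    rw [gt_iff_lt, lt_div_iff₀ (by linarith)]
    nlinarith [mul_pos (sub_pos.2 hUq) (show 0 < 1 + g - U - q by linarith)]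

/-! ### The average velocity -/

theorem map_choiceLaw (p : unitInterval) (i : ℤ) :
    (choiceLaw p).map (fun ω s (j : ℕ) => ω (i + j, s)) = rowLaw p := by
  have hinj : Function.Injective fun z : ℕ × ℕ => ((i + z.2, z.1) : ℤ × ℕ) := by
    rintro ⟨a, b⟩ ⟨c, d⟩ h
    simp only [Prod.mk.injEq, add_right_inj, Nat.cast_inj] at h
    rw [h.1, h.2]
  have h1 := Measure.map_infinitePi_infinitePi_of_inj
    (P := fun _ : ℤ × ℕ => bernoulliMeasure true false p) hinj
  have h2 := Measure.infinitePi_map_curry fun _ _ : ℕ => bernoulliMeasure true false p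
  rw [rowLaw, ← h2, ← h1, Measure.map_map (by fun_prop) (by fun_prop)]
  rfl

theorem tendsto_shift_div_of_hasDensity {x : ℤ → ℝ} {ρ : ℝ} (hρ : 0 < ρ) (hx : HasDensity x ρ)
    (i : ℤ) : Tendsto (fun j : ℕ => x (i + j) / j) atTop (𝓝 ρ⁻¹) := by
  have hinv := hx.inv₀ hρ.ne'
  have hidx : Tendsto (fun j : ℕ => (i + j + 1).toNat) atTop atTop :=
    tendsto_atTop.2 fun b => by
      filter_upwards [eventually_ge_atTop (b + i.natAbs)] with j hj
      omega
  have h1 := hinv.comp hidx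
  have h2 : Tendsto (fun j : ℕ => 1 + ((i : ℝ) + 1) / j) atTop (𝓝 (1 + 0)) :=
    tendsto_const_nhds.add (tendsto_const_div_atTop_nhds_zero_nat _)
  have h3 := (h1.mul h2).add (tendsto_const_div_atTop_nhds_zero_nat (x 0))
  rw [add_zero, add_zero, mul_one] at h3
  refine h3.congr' ?_
  filter_upwards [eventually_ge_atTop (i.natAbs + 1)] with j hj
  have hj0 : (j : ℝ) ≠ 0 := by
    have : j ≠ 0 := by omega
    exact_mod_cast this
  have hcast : (((i + j + 1).toNat : ℕ) : ℤ) = i + j + 1 := Int.toNat_of_nonneg (by omega)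
  have hcast' : (((i + j + 1).toNat : ℕ) : ℝ) = i + j + 1 := by exact_mod_cast hcast
  have hne : ((i : ℝ) + j + 1) ≠ 0 := by
    have : i + j + 1 ≠ 0 := by omega
    exact_mod_cast this
  simp only [Function.comp_apply, hcast, hcast', inv_div, add_sub_cancel_right]
  field_simp
  ring

theorem hasAverageVelocity {ρ v r : ℝ} (hρ : 0 < ρ) (hv : 0 < v) (hr : 2 * r < ρ⁻¹)
    {p : unitInterval} (hp : 0 < p) :
    HasAverageVelocity ρ p v r (v * slopeVelocity ((ρ⁻¹ - 2 * r) / v) p) := by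
  intro x _ hx
  refine ae_all_iff.2 fun i => ?_
  have hslope : Tendsto (fun j : ℕ => (x (i + j) - 2 * r * j) / v / j) atTop
      (𝓝 ((ρ⁻¹ - 2 * r) / v)) := by
    refine (((tendsto_shift_div_of_hasDensity hρ hx i).sub_const (2 * r)).div_const v).congr' ?_
    filter_upwards [eventually_gt_atTop 0] with j hj
    have : (j : ℝ) ≠ 0 := by positivity
    field_simp
  have hae := ae_tendsto_slopeVelocity hp (div_pos (sub_pos.2 hr) hv) hslope
  rw [← map_choiceLaw p i] at hae
  have hmeas : Measurable fun (ω : Choices) s (j : ℕ) => ω (i + j, s) := by fun_prop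
  filter_upwards [ae_of_ae_map hmeas.aemeasurable hae] with ω hω
  have h := (hω.const_mul v).sub (tendsto_const_div_atTop_nhds_zero_nat (x i))
  rw [sub_zero] at h
  refine h.congr fun t => ?_
  have he := evolve_eq_halfEvolve hv r x ω i t 0
  simp only [Nat.cast_zero, add_zero, mul_zero] at he
  rw [he]
  ring

theorem exists_hasDensity {ρ r : ℝ} (hρ : 0 < ρ) (hr : 2 * r ≤ ρ⁻¹) :
    ∃ x : ℤ → ℝ, IsAdmissible r x ∧ HasDensity x ρ := by
  refine ⟨fun i => i * ρ⁻¹, fun i => ?_, ?_⟩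
  · push_cast
    linarith
  · have h : Tendsto (fun n : ℕ => ρ / (1 - 1 / (n : ℝ))) atTop (𝓝 (ρ / (1 - 0))) :=
      tendsto_const_nhds.div (tendsto_const_nhds.sub (tendsto_const_div_atTop_nhds_zero_nat 1))
        (by norm_num)
    rw [sub_zero, div_one] at h
    refine h.congr' ?_
    filter_upwards [eventually_gt_atTop 1] with n hn
    have hn' : (1 : ℝ) < n := by exact_mod_cast hn
    have h1 : (n : ℝ) - 1 ≠ 0 := by linarith
    push_cast
    field_simp
    simp

theorem velocityWellDefined_and_eq {ρ v r : ℝ} (hρ : 0 < ρ) (hv : 0 < v) (hr : 2 * r < ρ⁻¹)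
    {p : unitInterval} (hp : 0 < p) :
    VelocityWellDefined ρ p v r ∧
      averageVelocity ρ p v r = v * slopeVelocity ((ρ⁻¹ - 2 * r) / v) p := by
  have hV := hasAverageVelocity hρ hv hr hp
  obtain ⟨x, hx, hd⟩ := exists_hasDensity hρ hr.le
  have huniq (c c' : ℝ) (h : HasAverageVelocity ρ p v r c) (h' : HasAverageVelocity ρ p v r c') :
      c = c' := by
    have : IsProbabilityMeasure (choiceLaw p) := by unfold choiceLaw; infer_instance
    obtain ⟨ω, h1, h2⟩ := ((h x hx hd).and (h' x hx hd)).exists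
    exact tendsto_nhds_unique (h1 0) (h2 0)
  exact ⟨⟨⟨x, hx, hd⟩, _, hV, fun c hc => huniq _ _ hc hV⟩,
    huniq _ _ (Classical.epsilon_spec ⟨_, hV⟩) hV⟩

theorem mul_slopeVelocity {v ρ : ℝ} (hv : 0 < v) (hρ : 0 < ρ) (p : ℝ) :
    v * slopeVelocity ((v * ρ)⁻¹) p =
      (1 + v * ρ - √((1 + v * ρ) ^ 2 - 4 * p * v * ρ)) / (2 * ρ) := by
  have h : 0 < v * ρ := mul_pos hv hρ
  have hsq : √((1 + v * ρ) ^ 2 - 4 * p * v * ρ) =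
      v * ρ * √((1 + (v * ρ)⁻¹) ^ 2 - 4 * p * (v * ρ)⁻¹) := by
    rw [← Real.sqrt_sq h.le, ← Real.sqrt_mul (sq_nonneg _), Real.sqrt_sq h.le]
    congr 1
    field_simp
    ring
  rw [hsq, slopeVelocity]
  field_simp
  ring

end ExclusionProcess

theorem corollaryc (v ρ : ℝ) (hv : 0 < v) (hρ : 0 < ρ) :
    (∀ p : unitInterval, 0 < p →
      ExclusionProcess.VelocityWellDefined ρ p v 0 ∧
      ExclusionProcess.VelocityWellDefined (v * ρ) p 1 0 ∧
      ExclusionProcess.VelocityWellDefined (v * ρ / (1 + v * ρ)) p 1 (1 / 2) ∧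
      ExclusionProcess.averageVelocity ρ p v 0 =
        v * ExclusionProcess.averageVelocity (v * ρ) p 1 0 ∧
      ExclusionProcess.averageVelocity ρ p v 0 =
        v * ExclusionProcess.averageVelocity (v * ρ / (1 + v * ρ)) p 1 (1 / 2) ∧
      ExclusionProcess.averageVelocity ρ p v 0 =
        (1 + v * ρ - Real.sqrt ((1 + v * ρ) ^ 2 - 4 * (p : ℝ) * v * ρ)) / (2 * ρ)) ∧
    Tendsto (fun p : unitInterval => ExclusionProcess.averageVelocity ρ p v 0)
      (𝓝[<] 1) (𝓝 (min v (1 / ρ))) ∧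
    ExclusionProcess.averageVelocity ρ 1 v 0 = min v (1 / ρ) ∧
    Tendsto (fun p : unitInterval => ExclusionProcess.averageVelocity ρ p v 0)
      (𝓝[<] 1) (𝓝 (ExclusionProcess.averageVelocity ρ 1 v 0)) := by
  have hvρ : 0 < v * ρ := mul_pos hv hρ
  have hA {p : unitInterval} (hp : 0 < p) := ExclusionProcess.velocityWellDefined_and_eq
    (r := 0) hρ hv (by simpa using hρ) hp
  have hB {p : unitInterval} (hp : 0 < p) := ExclusionProcess.velocityWellDefined_and_eq
    (r := 0) hvρ one_pos (by rw [mul_zero]; exact inv_pos.2 hvρ) hp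
  have hinv : (v * ρ / (1 + v * ρ))⁻¹ = (v * ρ)⁻¹ + 1 := by
    field_simp
  have hC {p : unitInterval} (hp : 0 < p) := ExclusionProcess.velocityWellDefined_and_eq
    (ρ := v * ρ / (1 + v * ρ)) (r := 1 / 2) (by positivity) one_pos
    (by rw [hinv]; linarith [inv_pos.2 hvρ]) hp
  have hgA : (ρ⁻¹ - 2 * 0) / v = (v * ρ)⁻¹ := by
    field_simp
    simp
  have hgB : ((v * ρ)⁻¹ - 2 * 0) / 1 = (v * ρ)⁻¹ := by simp
  have hgC : ((v * ρ / (1 + v * ρ))⁻¹ - 2 * (1 / 2)) / 1 = (v * ρ)⁻¹ := by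
    rw [hinv]
    ring
  simp only [hgA] at hA
  simp only [hgB] at hB
  simp only [hgC] at hC
  have hone : ExclusionProcess.averageVelocity ρ 1 v 0 = min v (1 / ρ) := by
    rw [(hA one_pos).2, Set.Icc.coe_one, ExclusionProcess.slopeVelocity_one,
      mul_min_of_nonneg _ _ hv.le, mul_one]
    congr 1
    field_simp
  have hlim : Tendsto (fun p : unitInterval => ExclusionProcess.averageVelocity ρ p v 0)
      (𝓝[<] 1) (𝓝 (ExclusionProcess.averageVelocity ρ 1 v 0)) := by
    have hcont : Continuous fun p : unitInterval =>
        v * ExclusionProcess.slopeVelocity (v * ρ)⁻¹ p := by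
      unfold ExclusionProcess.slopeVelocity
      fun_prop
    rw [(hA one_pos).2]
    refine ((hcont.tendsto 1).mono_left nhdsWithin_le_nhds).congr' ?_
    filter_upwards [nhdsWithin_le_nhds (Ioi_mem_nhds (show (0 : unitInterval) < 1 from one_pos))]
      with p hp
    exact ((hA hp).2).symm
  refine ⟨fun p hp => ⟨(hA hp).1, (hB hp).1, (hC hp).1, ?_, ?_, ?_⟩, hone ▸ hlim, hone, hlim⟩
  · rw [(hA hp).2, (hB hp).2, one_mul]
  · rw [(hA hp).2, (hC hp).2, one_mul]
  · rw [(hA hp).2, ExclusionProcess.mul_slopeVelocity hv hρ]
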